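/- Let $p$ be an odd prime. A $p$-core $p'$-partition is an integer partition (of any size) none of whose hook lengths and none of whose parts is divisible by $p$. A largest such partition is one of maximal size (sum of parts). The abacus of a partition $\lambda=(\lambda_1\ge\dots\ge\lambda_\ell>0)$ has beads in the positions $\lambda_k+\ell-k$ for $1\le k\le \ell$, and gaps in all other positions $0,1,2,\dots$; the positions are arranged in rows of length $p$, the $j$th row ($j\ge 1$) consisting of the positions $(j-1)p,\dots,jp-1$ from left to right. Each bead contributes the part whose size is the number of gaps in positions before it. If $\lambda$ is $p$-core and all beads are rightmost in their rows, then all beads in one row contribute parts of the same size, and the abacus residue sequence of $\lambda$ is the sequence, from the top row to the bottom row, of the residues modulo $p$ of the sizes of the parts contributed by the rows that contain beads. The additive residue graph $\mathcal{G}_p$ is the labelled directed graph whose vertices are the residue classes modulo $p$, with an edge labelled $i$ from $r$ to $r+i$ for each residue $r$ and each $1\le i\le p-1$. A walk on $\mathcal{G}_p$ here means a finite directed walk that starts at $0$, traverses edges with labels in weakly increasing order, and never revisits $0$. Its length is its number of edges. Theorem. There is a unique largest $p$-core $p'$-partition, and there is a unique longest walk on $\mathcal{G}_p$. They correspond: all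 beads on the abacus of the largest $p$-core $p'$-partition are rightmost in their rows, and its abacus residue sequence is precisely the sequence of vertices visited by the longest walk after its start at $0$. -/

import Mathlib

/-! Integer partitions (of arbitrary size) are Young diagrams: the parts are the row lengths
`μ.rowLens`, the size is `μ.card`, and `μ.colLen 0` is the number of parts. -/

/-- The hook length of the cell in row `i` and column `j` (both counted from `0`): the arm, plus
the leg, plus one. -/
def hookLength (μ : YoungDiagram) (i j : ℕ) : ℕ :=
  (μ.rowLen i - (j + 1)) + (μ.colLen j - (i + 1)) + 1

/-- A partition is `p`-core if none of its hook lengths is divisible by `p`. -/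
def IsCorePartition (p : ℕ) (μ : YoungDiagram) : Prop :=
  ∀ i j : ℕ, (i, j) ∈ μ → ¬ p ∣ hookLength μ i j

/-- A `p'`-partition: none of its parts is divisible by `p`. -/
def IsPrimePartition (p : ℕ) (μ : YoungDiagram) : Prop :=
  ∀ a ∈ μ.rowLens, ¬ p ∣ a

/-- A largest `p`-core `p'`-partition: one of maximal size. -/
def IsLargestCorePrimePartition (p : ℕ) (μ : YoungDiagram) : Prop :=
  IsCorePartition p μ ∧ IsPrimePartition p μ ∧
    ∀ ν : YoungDiagram, IsCorePartition p ν → IsPrimePartition p ν → ν.card ≤ μ.card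

/-- The bead positions on the abacus of a partition, normalised to have a gap in position `0`:
there is one bead for each part, and the bead of the `k`-th part (counted from `0`) is in the
position given by the size of that part plus the number of later parts. Position `n` lies on
runner `n % p` and in row `n / p` (rows counted from `0`) of the `p`-abacus. -/
def beads (μ : YoungDiagram) : Finset ℕ :=
  (Finset.range (μ.colLen 0)).image fun k => μ.rowLen k + (μ.colLen 0 - (k + 1))

/-- The number of gaps in positions before `n`. If `n` holds a bead, this is the size of the part
contributed by that bead. -/
def gapsBefore (μ : YoungDiagram) (n : ℕ) : ℕ :=
  ((Finset.range n).filter fun m => m ∉ beads μ).card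

/-- All beads of the `p`-abacus are rightmost in their rows: the position to the right of a bead
in the same row (if there is one) also holds a bead. -/
def BeadsRightmost (p : ℕ) (μ : YoungDiagram) : Prop :=
  ∀ n ∈ beads μ, n % p + 1 < p → n + 1 ∈ beads μ

/-- The rows of the `p`-abacus that contain a bead, from top to bottom. -/
def beadRows (p : ℕ) (μ : YoungDiagram) : List ℕ :=
  ((beads μ).image fun n => n / p).sort (· ≤ ·)

/-- The abacus residue sequence of a `p`-core partition whose beads are rightmost in their rows:
the residues modulo `p` of the sizes of the parts contributed by the rows containing beads. All
beads of such a row `j` contribute parts of the same size, which is read off at the last position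
`j * p + (p - 1)` of the row. -/
def abacusResidueSequence (p : ℕ) (μ : YoungDiagram) : List (ZMod p) :=
  (beadRows p μ).map fun j => (gapsBefore μ (j * p + (p - 1)) : ZMod p)

/-- The edges of the additive residue graph, whose vertices are the residue classes modulo `p`:
for each residue `r` and each label `1 ≤ i ≤ p - 1`, one edge from `r` to `r + i`. -/
structure ResidueEdge (p : ℕ) where
  source : ZMod p
  label : ℕ
  one_le_label : 1 ≤ label
  label_le : label ≤ p - 1

/-- The endpoint of an edge. -/
def ResidueEdge.target {p : ℕ} (e : ResidueEdge p) : ZMod p :=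
  e.source + (e.label : ZMod p)

/-- The (restricted) walks on the additive residue graph: they start at `0`, traverse edges in
weakly increasing order of labels, and never revisit `0`. -/
structure ResidueWalk (p : ℕ) where
  edges : List (ResidueEdge p)
  starts_at_zero : ∀ e ∈ edges.head?, e.source = 0
  consecutive : edges.IsChain fun e f => e.target = f.source
  labels_increasing : edges.IsChain fun e f => e.label ≤ f.label
  avoids_zero : ∀ e ∈ edges, e.target ≠ 0

/-- The number of edges traversed. -/
def ResidueWalk.length {p : ℕ} (w : ResidueWalk p) : ℕ := w.edges.length

/-- The vertices visited by the walk, in order, after its start at `0`. -/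
def ResidueWalk.visited {p : ℕ} (w : ResidueWalk p) : List (ZMod p) :=
  w.edges.map ResidueEdge.target

/-- A longest walk: one with the maximal number of edges. -/
def IsLongestWalk {p : ℕ} (w : ResidueWalk p) : Prop :=
  ∀ v : ResidueWalk p, v.length ≤ w.length

/-- The partition `μ` corresponds to the walk `w`: the beads of `μ` are rightmost in their rows
and its abacus residue sequence is the sequence of vertices visited by `w`. -/
def CorrespondsToWalk (p : ℕ) (μ : YoungDiagram) (w : ResidueWalk p) : Prop :=
  BeadsRightmost p μ ∧ abacusResidueSequence p μ = w.visited

/-!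
Let `p` be an odd prime. If the beads of a `p`-core are rightmost in their rows, then the numbers of
gaps in its rows increase weakly, and the parts contributed by the `j`-th row have the size
`g[0] + ⋯ + g[j]`, where `g[i]` is the number of gaps in row `i`. So `p`-core `p'`-partitions of this
kind are the same thing as walks, with `g` as the sequence of labels (`IsLabelSequence`), and it
remains to compare walks with one another and to deal with the other cores.

*Walks.* Let `s i` be the vertex that a walk has reached once the labels `≤ i` are used up. Measure
vertices by the number of steps with label `i` that lead there from `0` (`stepsTo`). As the walk
avoids `0`, the label `i` occurs `stepsTo p i (s i) - stepsTo p i (s (i - 1))` times. Hence the length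
is the sum over `i` of `switchGain p i (s i) = stepsTo p i (s i) - stepsTo p (i + 1) (s i)`, and the
choices of the `s i` are independent except that the multiplicities must not be negative. The function
`switchGain p i` is injective, and its maximum is large enough for the unique maximising vertices to
be compatible (`exists_isOptimalLabels`). This gives the unique longest walk. The numbers of gaps and
of beads contributed at `s i` are, up to the factor `p`, a floor and a ceiling of a multiple of
`switchGain p i (s i)`, so that they are maximal as well (`gaps_le_of_switchGain_le`,
`beads_le_of_switchGain_le`). Consequently the optimal walk maximises the sum of `c` over the labels
for each nonnegative concave `c` (`IsOptimalLabels.sum_map_le`). The size is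
a quadratic form in the multiplicities, with kernel `min a b * (p - max a b)` and a linear term given
by the diagonal of the kernel. The kernel is concave in each variable, so the optimal walk is also the
unique walk of maximal size (`IsOptimalLabels.sizeOfLabels_le`).

*Other cores.* Cut the abacus of a `p`-core `p'`-partition into pieces of `p` positions, backwards
from its last bead. In a core all the cuts come after a bead, so the numbers of gaps in the pieces are
again the labels of a walk. The size of the partition of this walk is at least the size of the given
one, with equality only if the beads were rightmost in their rows to begin with
(`exists_labels_of_core`).
-/

/-! ### Label sequences -/

/-- The sequences of edge labels of the walks on the additive residue graph. The vertices visited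
are the residues of the nonempty partial sums. -/
structure IsLabelSequence (p : ℕ) (g : List ℕ) : Prop where
  pairwise_le : g.Pairwise (· ≤ ·)
  one_le : ∀ a ∈ g, 1 ≤ a
  lt : ∀ a ∈ g, a < p
  not_dvd : ∀ j < g.length, ¬ p ∣ (g.take (j + 1)).sum

/-- The size of the partition whose `j`-th row of beads is right-justified and has `g[j]` gaps,
for every `j`: that row holds `p - g[j]` beads, and each contributes a part of size
`g[0] + ⋯ + g[j]`. -/
def sizeOfLabels (p : ℕ) (g : List ℕ) : ℕ :=
  ∑ j ∈ Finset.range g.length, (p - g.getD j 0) * (g.take (j + 1)).sum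

/-- The vertex reached by a walk with labels `g` once all the labels `≤ i` have been used. -/
def residueUpTo (p : ℕ) (g : List ℕ) (i : ℕ) : ZMod p :=
  ((g.filter (· ≤ i)).sum : ℕ)

/-- The number of steps with label `i` that lead from `0` to `s`. For `i = p` the inverse is
`0⁻¹ = 0`, so that this is `0`; this convention is used for the boundary term in
`IsLabelSequence.sum_map_eq`. -/
def stepsTo (p : ℕ) (i : ℕ) (s : ZMod p) : ℕ :=
  (s * (i : ZMod p)⁻¹).val

/-- What the passage from label `i` to label `i + 1` at the vertex `s` contributes to the length
of a walk. -/
def switchGain (p : ℕ) (i : ℕ) (s : ZMod p) : ℤ :=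
  stepsTo p i s - stepsTo p (i + 1) s

theorem IsLabelSequence.nil (p : ℕ) : IsLabelSequence p [] :=
  ⟨List.Pairwise.nil, by simp, by simp, by simp⟩

theorem isLabelSequence_append_singleton {p : ℕ} {g : List ℕ} {a : ℕ} :
    IsLabelSequence p (g ++ [a]) ↔
      IsLabelSequence p g ∧ (∀ b ∈ g, b ≤ a) ∧ 1 ≤ a ∧ a < p ∧ ¬ p ∣ g.sum + a := by
  constructor
  · rintro ⟨h1, h2, h3, h4⟩
    refine ⟨⟨(List.pairwise_append.1 h1).1, fun b hb => h2 b (by simp [hb]),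
      fun b hb => h3 b (by simp [hb]), fun j hj => ?_⟩, fun b hb => ?_, h2 a (by simp),
      h3 a (by simp), ?_⟩
    · have := h4 j (by simp; omega)
      rwa [List.take_append_of_le_length (by omega)] at this
    · exact (List.pairwise_append.1 h1).2.2 b hb a (by simp)
    · have := h4 g.length (by simp)
      rwa [List.take_of_length_le (by simp), List.sum_append, List.sum_singleton] at this
  · rintro ⟨⟨h1, h2, h3, h4⟩, h5, h6, h7, h8⟩
    refine ⟨List.pairwise_append.2 ⟨h1, by simp, by simpa using h5⟩, ?_, ?_, fun j hj => ?_⟩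
    · intro b hb
      rcases List.mem_append.1 hb with hb | hb
      · exact h2 b hb
      · simp_all
    · intro b hb
      rcases List.mem_append.1 hb with hb | hb
      · exact h3 b hb
      · simp_all
    · by_cases hj' : j < g.length
      · rw [List.take_append_of_le_length (by omega)]
        exact h4 j hj'
      · rw [List.take_of_length_le (by simp; omega), List.sum_append, List.sum_singleton]
        exact h8

theorem sizeOfLabels_append_singleton (p : ℕ) (g : List ℕ) (a : ℕ) :
    sizeOfLabels p (g ++ [a]) = sizeOfLabels p g + (p - a) * (g.sum + a) := by
  unfold sizeOfLabels
  rw [List.length_append, List.length_singleton, Finset.sum_range_succ]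
  congr 1
  · refine Finset.sum_congr rfl fun j hj => ?_
    have hj := Finset.mem_range.1 hj
    rw [List.take_append_of_le_length (by omega), List.getD_append _ _ _ _ hj]
  · rw [List.take_of_length_le (by simp), List.sum_append, List.sum_singleton]
    simp

/-- The number of pairs of a gap in the upper and a bead in the lower of two rows of the abacus with
`a` and `b` gaps, the row with fewer gaps being the upper one. -/
def labelKernel (p a b : ℕ) : ℤ := min a b * (p - max a b)

theorem labelKernel_comm (p a b : ℕ) : labelKernel p a b = labelKernel p b a := by
  rw [labelKernel, labelKernel, min_comm, max_comm]

theorem labelKernel_of_le {a b : ℕ} (p : ℕ) (h : a ≤ b) : labelKernel p a b = a * (p - b) := by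
  simp [labelKernel, h]

theorem sum_map_sum_map_comm (u v : List ℕ) (f : ℕ → ℕ → ℤ) :
    (u.map fun a => (v.map fun b => f a b).sum).sum =
      (v.map fun b => (u.map fun a => f a b).sum).sum := by
  induction u with
  | nil => simp
  | cons a u ih => simp [ih, List.sum_map_add]

/-- The size counts the pairs of a gap and a later bead, so that it is quadratic in the
multiplicities of the labels. -/
theorem IsLabelSequence.two_mul_sizeOfLabels {g : List ℕ} (hg : IsLabelSequence p g) :
    (2 * sizeOfLabels p g : ℤ) =
      (g.map fun a => (g.map fun b => labelKernel p b a).sum).sum +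
        (g.map fun a => labelKernel p a a).sum := by
  induction g using List.reverseRecOn with
  | nil => simp [sizeOfLabels]
  | append_singleton g a ih =>
    obtain ⟨hg', hle, h1, hlt, -⟩ := isLabelSequence_append_singleton.1 hg
    have ih := ih hg'
    have e1 : (g.map fun b => labelKernel p b a).sum = (g.sum : ℤ) * (p - a) := by
      rw [List.map_congr_left (g := fun b : ℕ => (b : ℤ) * (p - a))
        fun b hb => labelKernel_of_le p (hle b hb), List.sum_map_mul_right]
      simp
    have e2 : (g.map fun b => labelKernel p a b).sum = (g.sum : ℤ) * (p - a) := by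
      rw [← e1]
      simp only [labelKernel_comm p a]
    have e3 := labelKernel_of_le p (le_refl a)
    rw [sizeOfLabels_append_singleton]
    simp only [List.map_append, List.sum_append, List.map_singleton, List.sum_singleton,
      List.sum_map_add, e1, e2, e3]
    push_cast [hlt.le]
    linear_combination ih

section

variable {p : ℕ} [hp : Fact p.Prime]

theorem natCast_ne_zero_of_lt {i : ℕ} (h1 : 1 ≤ i) (h2 : i < p) : (i : ZMod p) ≠ 0 := by
  rw [Ne, ZMod.natCast_eq_zero_iff]
  exact fun h => absurd (Nat.le_of_dvd h1 h) (by omega)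

theorem stepsTo_lt (i : ℕ) (s : ZMod p) : stepsTo p i s < p := ZMod.val_lt _

theorem stepsTo_zero_right (i : ℕ) : stepsTo p i 0 = 0 := by simp [stepsTo]

theorem stepsTo_self (s : ZMod p) : stepsTo p p s = 0 := by simp [stepsTo]

theorem natCast_stepsTo (i : ℕ) (s : ZMod p) :
    (stepsTo p i s : ZMod p) = s * (i : ZMod p)⁻¹ := by
  simp [stepsTo]

theorem mul_stepsTo {i : ℕ} (h1 : 1 ≤ i) (h2 : i < p) (s : ZMod p) :
    (i : ZMod p) * (stepsTo p i s : ZMod p) = s := by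
  rw [natCast_stepsTo]
  have := natCast_ne_zero_of_lt h1 h2
  field_simp

theorem stepsTo_mul_natCast {i : ℕ} (h1 : 1 ≤ i) (h2 : i < p) {x : ℕ} (hx : x < p) :
    stepsTo p i ((i * x : ℕ) : ZMod p) = x := by
  have := natCast_ne_zero_of_lt h1 h2
  have h : (((i * x : ℕ) : ZMod p)) * (i : ZMod p)⁻¹ = x := by
    push_cast
    field_simp
  rw [stepsTo, h, ZMod.val_natCast, Nat.mod_eq_of_lt hx]

theorem stepsTo_add_self {i : ℕ} (h1 : 1 ≤ i) (h2 : i < p) {s : ZMod p} (hs : s + i ≠ 0) :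
    stepsTo p i (s + i) = stepsTo p i s + 1 := by
  have hi := natCast_ne_zero_of_lt h1 h2
  have hlt := stepsTo_lt i s
  have e : s + i = ((i * (stepsTo p i s + 1) : ℕ) : ZMod p) := by
    push_cast
    rw [mul_add, mul_stepsTo h1 h2, mul_one]
  by_cases h : stepsTo p i s + 1 < p
  · rw [e, stepsTo_mul_natCast h1 h2 h]
  · have : stepsTo p i s + 1 = p := by omega
    rw [this] at e
    simp [e] at hs

theorem residueUpTo_append_singleton_of_lt (g : List ℕ) {a i : ℕ} (h : i < a) :
    residueUpTo p (g ++ [a]) i = residueUpTo p g i := by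
  simp [residueUpTo, List.filter_append, h]

theorem residueUpTo_of_forall_le {g : List ℕ} {i : ℕ} (h : ∀ b ∈ g, b ≤ i) :
    residueUpTo p g i = (g.sum : ℕ) := by
  rw [residueUpTo, List.filter_eq_self.2 (by simpa using h)]

theorem IsLabelSequence.residueUpTo_zero {g : List ℕ} (hg : IsLabelSequence p g) :
    residueUpTo p g 0 = 0 := by
  rw [residueUpTo, List.filter_eq_nil_iff.2]
  · simp
  · intro a ha
    have := hg.one_le a ha
    simp; omega

/-- Along the edges with label `i + 1`, the number `stepsTo p (i + 1)` grows by one with each step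
and never wraps around modulo `p`, since the walk avoids `0`. -/
theorem IsLabelSequence.stepsTo_add_count {g : List ℕ} (hg : IsLabelSequence p g) (i : ℕ) :
    stepsTo p (i + 1) (residueUpTo p g i) + g.count (i + 1) =
      stepsTo p (i + 1) (residueUpTo p g (i + 1)) := by
  induction g using List.reverseRecOn with
  | nil => simp [residueUpTo]
  | append_singleton g a ih =>
    obtain ⟨hg', hle, h1, hlt, hnd⟩ := isLabelSequence_append_singleton.1 hg
    have ih := ih hg'
    rcases lt_trichotomy a (i + 1) with h | h | h
    · rw [residueUpTo_of_forall_le (i := i), residueUpTo_of_forall_le (i := i + 1),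
        List.count_eq_zero_of_not_mem]
      · rfl
      · intro hm
        rcases List.mem_append.1 hm with hm | hm
        · have := hle _ hm; omega
        · simp at hm; omega
      all_goals
        intro b hb
        rcases List.mem_append.1 hb with hb | hb
        · have := hle _ hb; omega
        · simp at hb; omega
    · subst h
      rw [residueUpTo_append_singleton_of_lt g (Nat.lt_succ_self i)]
      rw [residueUpTo_of_forall_le (i := i + 1) (g := g ++ [i + 1]), List.count_append, ← add_assoc, ih,
        residueUpTo_of_forall_le hle, List.sum_append, List.sum_singleton, Nat.cast_add,
        stepsTo_add_self h1 hlt]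
      · simp
      · rwa [← Nat.cast_add, Ne, ZMod.natCast_eq_zero_iff]
      · intro b hb
        rcases List.mem_append.1 hb with hb | hb
        · exact hle b hb
        · simp at hb; omega
    · rw [residueUpTo_append_singleton_of_lt g h,
        residueUpTo_append_singleton_of_lt g (by omega : i < a), ← ih, List.count_append,
        List.count_singleton]
      simp; omega

/-- Summation by parts: a sum over the labels of a walk is a sum over the passages from each label
to the next, each term of which depends on the vertex of that passage only. -/
theorem IsLabelSequence.sum_map_eq {g : List ℕ} (hg : IsLabelSequence p g) (c : ℕ → ℤ) :
    (g.map c).sum = ∑ k ∈ Finset.range (p - 1),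
      (c (k + 1) * stepsTo p (k + 1) (residueUpTo p g (k + 1)) -
        c (k + 2) * stepsTo p (k + 2) (residueUpTo p g (k + 1))) := by
  have h1 : (g.map c).sum = ∑ k ∈ Finset.range (p - 1), (g.count (k + 1) : ℤ) * c (k + 1) := by
    rw [Finset.sum_range fun k => (g.count (k + 1) : ℤ) * c (k + 1)]
    rw [Finset.sum_list_map_count]
    rw [← Finset.sum_range fun k => (g.count (k + 1) : ℤ) * c (k + 1)]
    rw [Finset.range_eq_Ico, Finset.sum_Ico_add' (fun k => (g.count k : ℤ) * c k) 0 (p - 1) 1]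
    simp only [nsmul_eq_mul]
    refine Finset.sum_subset (fun a ha => ?_) fun a _ ha => ?_
    · have ha := List.mem_toFinset.1 ha
      have := hg.one_le a ha
      have := hg.lt a ha
      simp; omega
    · rw [List.count_eq_zero_of_not_mem (by simpa using ha)]
      simp
  set A : ℕ → ℤ := fun k => c (k + 1) * stepsTo p (k + 1) (residueUpTo p g k) with hA
  have h2 : ∀ k ∈ Finset.range (p - 1), (g.count (k + 1) : ℤ) * c (k + 1) =
      (c (k + 1) * stepsTo p (k + 1) (residueUpTo p g (k + 1)) -
        c (k + 2) * stepsTo p (k + 2) (residueUpTo p g (k + 1))) + (A (k + 1) - A k) := by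
    intro k _
    have := hg.stepsTo_add_count k
    simp only [hA]
    rw [← this]
    push_cast
    ring
  rw [h1, Finset.sum_congr rfl h2, Finset.sum_add_distrib, Finset.sum_range_sub]
  have : p - 1 + 1 = p := Nat.sub_add_cancel hp.out.one_le
  simp only [hA, this, stepsTo_self, hg.residueUpTo_zero, stepsTo_zero_right]
  simp

/-! ### The vertices at which the label changes -/

theorem dvd_mul_stepsTo_sub {i : ℕ} (h1 : 1 ≤ i) (h2 : i + 1 < p) (s : ZMod p) :
    (p : ℤ) ∣ i * stepsTo p i s - (i + 1) * stepsTo p (i + 1) s := by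
  rw [← ZMod.intCast_zmod_eq_zero_iff_dvd]
  have e1 := mul_stepsTo h1 (by omega) s
  have e2 := mul_stepsTo (by omega) h2 s
  push_cast at e2 ⊢
  rw [e1, e2, sub_self]

theorem le_of_dvd_of_sub_lt {p a b : ℤ} (ha : p ∣ a) (hb : p ∣ b) (h : a - b < p) : a ≤ b := by
  by_contra! hab
  have := Int.le_of_dvd (by omega) (dvd_sub ha hb)
  omega

/-- The number of gaps contributed by the passage from label `i` to label `i + 1` at `s` is
monotone in the gain: it is `p * ⌊i * gain / p⌋` if `i + 1 < p`. -/
theorem gaps_le_of_switchGain_le {i : ℕ} (h1 : 1 ≤ i) (h2 : i < p) {s t : ZMod p}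
    (h : switchGain p i s ≤ switchGain p i t) :
    (i * stepsTo p i s - (i + 1) * stepsTo p (i + 1) s : ℤ) ≤
      i * stepsTo p i t - (i + 1) * stepsTo p (i + 1) t := by
  unfold switchGain at h
  have hmul := mul_le_mul_of_nonneg_left h (Int.natCast_nonneg i)
  rcases Nat.lt_or_ge (i + 1) p with hi | hi
  · refine le_of_dvd_of_sub_lt (dvd_mul_stepsTo_sub h1 hi s) (dvd_mul_stepsTo_sub h1 hi t) ?_
    have := stepsTo_lt (i + 1) t
    linarith [(Int.natCast_nonneg (stepsTo p (i + 1) s)), (Int.ofNat_lt.2 this)]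
  · obtain rfl : p = i + 1 := by omega
    simp only [stepsTo_self] at *
    linarith

/-- The number of beads contributed by the passage from label `i` to label `i + 1` at `s` is
monotone in the gain: it is `p * ⌈(p - i) * gain / p⌉` if `i + 1 < p`. -/
theorem beads_le_of_switchGain_le {i : ℕ} (h1 : 1 ≤ i) (h2 : i < p) {s t : ZMod p}
    (h : switchGain p i s ≤ switchGain p i t) :
    ((p - i) * stepsTo p i s - (p - (i + 1)) * stepsTo p (i + 1) s : ℤ) ≤
      (p - i) * stepsTo p i t - (p - (i + 1)) * stepsTo p (i + 1) t := by
  unfold switchGain at h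
  have hmul := mul_le_mul_of_nonneg_left h (by omega : (0 : ℤ) ≤ p - i)
  rcases Nat.lt_or_ge (i + 1) p with hi | hi
  · have key : ∀ s : ZMod p, (p : ℤ) ∣
        (p - i) * stepsTo p i s - (p - (i + 1)) * stepsTo p (i + 1) s := fun s => by
      have := (dvd_mul_right (p : ℤ) (switchGain p i s)).sub (dvd_mul_stepsTo_sub h1 hi s)
      have e : (p : ℤ) * switchGain p i s -
          (i * stepsTo p i s - (i + 1) * stepsTo p (i + 1) s) =
          (p - i) * stepsTo p i s - (p - (i + 1)) * stepsTo p (i + 1) s := by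
        unfold switchGain
        ring
      rwa [e] at this
    refine le_of_dvd_of_sub_lt (key s) (key t) ?_
    have := stepsTo_lt (i + 1) s
    linarith [(Int.natCast_nonneg (stepsTo p (i + 1) t)), (Int.ofNat_lt.2 this)]
  · obtain rfl : p = i + 1 := by omega
    simp only [stepsTo_self] at *
    linarith

theorem switchGain_injective {i : ℕ} (h1 : 1 ≤ i) (h2 : i < p) :
    Function.Injective (switchGain p i) := by
  intro s t h
  unfold switchGain at h
  rcases Nat.lt_or_ge (i + 1) p with hi | hi
  · have key : ∀ s : ZMod p, s = i * (i + 1) *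
        (((stepsTo p i s - stepsTo p (i + 1) s : ℤ)) : ZMod p) := fun s => by
      have e1 := mul_stepsTo h1 (by omega) s
      have e2 := mul_stepsTo (by omega) hi s
      push_cast at e2 ⊢
      linear_combination (-(i + 1) : ZMod p) * e1 + (i : ZMod p) * e2
    rw [key s, key t, h]
  · obtain rfl : p = i + 1 := by omega
    simp only [stepsTo_self] at h
    have h : stepsTo (i + 1) i s = stepsTo (i + 1) i t := by omega
    rw [← mul_stepsTo h1 h2 s, ← mul_stepsTo h1 h2 t, h]

/-- The greatest gain is at least `(p - 1) / 2` for odd labels and at least `(p + 1) / 2` for even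
ones. -/
theorem half_le_switchGain (hodd : Odd p) {i : ℕ} (h1 : 1 ≤ i) (h2 : i < p) :
    ∃ s : ZMod p, (p - 1 : ℤ) + (if Odd i then 0 else 2) ≤ 2 * switchGain p i s := by
  -- `x` and `y` are the intended values of `stepsTo p i s` and `stepsTo p (i + 1) s`.
  have main : ∀ x y : ℕ, x < p → y < p → i + 1 < p → (∃ k : ℕ, i * x = (i + 1) * y + p * k) →
      switchGain p i ((i * x : ℕ) : ZMod p) = x - y := by
    rintro x y hx hy hi ⟨k, hk⟩
    have e : ((i * x : ℕ) : ZMod p) = (((i + 1) * y : ℕ) : ZMod p) := by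
      rw [hk]; simp
    unfold switchGain
    rw [stepsTo_mul_natCast h1 h2 hx, e, stepsTo_mul_natCast (by omega) hi hy]
  obtain ⟨q, rfl⟩ := hodd
  split_ifs with h
  · obtain ⟨r, rfl⟩ := h
    rcases Nat.lt_or_ge (2 * r + 1 + 1) (2 * q + 1) with hi | hi
    · refine ⟨_, le_of_le_of_eq ?_ (congrArg (2 * ·)
        (main (2 * q - r) (q - r) (by omega) (by omega) hi ⟨r, ?_⟩).symm)⟩
      · push_cast; omega
      · obtain ⟨d, rfl⟩ : ∃ d, q = r + d := ⟨q - r, by omega⟩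
        have : 2 * (r + d) - r = r + 2 * d := by omega
        rw [this, Nat.add_sub_cancel_left]
        ring
    · omega
  · obtain ⟨r, rfl⟩ := Nat.not_odd_iff_even.1 h
    rcases Nat.lt_or_ge (r + r + 1) (2 * q + 1) with hi | hi
    · refine ⟨_, le_of_le_of_eq ?_ (congrArg (2 * ·)
        (main (q + 1 + r) r (by omega) (by omega) hi ⟨r, by ring⟩).symm)⟩
      push_cast; omega
    · refine ⟨(((r + r) * (r + r) : ℕ) : ZMod (2 * q + 1)), ?_⟩
      obtain rfl : r = q := by omega
      have e : r + r + 1 = 2 * r + 1 := by ring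
      unfold switchGain
      rw [stepsTo_mul_natCast h1 h2 h2, e, stepsTo_self]
      push_cast; omega

/-- A walk that passes from each label to the next at the vertex of greatest gain. -/
def IsOptimalLabels (p : ℕ) (g : List ℕ) : Prop :=
  ∀ i, 1 ≤ i → i < p → ∀ s : ZMod p, switchGain p i s ≤ switchGain p i (residueUpTo p g i)

theorem IsLabelSequence.append_replicate {g : List ℕ} (hg : IsLabelSequence p g) {a : ℕ}
    (hle : ∀ b ∈ g, b ≤ a) (h1 : 1 ≤ a) (h2 : a < p) {n : ℕ}
    (hn : stepsTo p a ((g.sum : ℕ) : ZMod p) + n < p) :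
    IsLabelSequence p (g ++ List.replicate n a) := by
  induction n with
  | zero => simpa using hg
  | succ n ih =>
    rw [List.replicate_succ', ← List.append_assoc, isLabelSequence_append_singleton]
    refine ⟨ih (by omega), ?_, h1, h2, ?_⟩
    · intro b hb
      rcases List.mem_append.1 hb with hb | hb
      · exact hle b hb
      · exact (List.eq_of_mem_replicate hb).le
    · rw [← ZMod.natCast_eq_zero_iff]
      have e : ((((g ++ List.replicate n a).sum + a : ℕ)) : ZMod p) =
          a * ((stepsTo p a ((g.sum : ℕ) : ZMod p) + (n + 1) : ℕ) : ZMod p) := by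
        rw [Nat.cast_add (stepsTo _ _ _), mul_add, mul_stepsTo h1 h2]
        simp
        ring
      rw [e]
      exact mul_ne_zero (natCast_ne_zero_of_lt h1 h2) (natCast_ne_zero_of_lt (by omega) hn)

/-- The vertices of greatest gain are compatible: the maximal gains for two successive labels add
up to at least `p`, so that the number of steps needed between the two passages is not negative. -/
theorem exists_isOptimalLabels (hodd : Odd p) :
    ∃ g, IsLabelSequence p g ∧ IsOptimalLabels p g := by
  have hmax : ∀ i, ∃ s : ZMod p, ∀ t, switchGain p i t ≤ switchGain p i s := fun i =>
    Finite.exists_max (switchGain p i)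
  choose s hs using hmax
  have hgain : ∀ i, 1 ≤ i → i < p →
      (p - 1 : ℤ) + (if Odd i then 0 else 2) ≤ 2 * switchGain p i (s i) := fun i h1 h2 => by
    obtain ⟨t, ht⟩ := half_le_switchGain hodd h1 h2
    have := hs i t
    omega
  have hle : ∀ i, 1 ≤ i → i + 1 < p →
      stepsTo p (i + 1) (s i) ≤ stepsTo p (i + 1) (s (i + 1)) := fun i h1 h2 => by
    have a := hgain i h1 (by omega)
    have b := hgain (i + 1) (by omega) h2
    have hx := stepsTo_lt i (s i)
    have : (p : ℤ) ≤ switchGain p i (s i) + switchGain p (i + 1) (s (i + 1)) := by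
      simp only [Nat.odd_add_one] at b
      by_cases h : Odd i <;> simp only [h, not_true_eq_false, not_false_eq_true, if_true, if_false]
        at a b <;> omega
    unfold switchGain at this
    omega
  have build : ∀ i < p, ∃ g, IsLabelSequence p g ∧ (∀ b ∈ g, b ≤ i) ∧
      ∀ k, 1 ≤ k → k ≤ i → residueUpTo p g k = s k := by
    intro i
    induction i with
    | zero => exact fun _ => ⟨[], IsLabelSequence.nil p, by simp, by omega⟩
    | succ i ih =>
      intro hi
      obtain ⟨g, hg, hgle, hgs⟩ := ih (by omega)
      have hsum : residueUpTo p g i = (g.sum : ℕ) := residueUpTo_of_forall_le hgle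
      have hmono : stepsTo p (i + 1) ((g.sum : ℕ) : ZMod p) ≤
          stepsTo p (i + 1) (s (i + 1)) := by
        rcases Nat.eq_zero_or_pos i with rfl | h0
        · rw [← hsum, hg.residueUpTo_zero, stepsTo_zero_right]
          exact Nat.zero_le _
        · rw [← hsum, hgs i h0 le_rfl]
          exact hle i h0 hi
      obtain ⟨n, hn⟩ := Nat.exists_eq_add_of_le hmono
      have hb : ∀ b ∈ g ++ List.replicate n (i + 1), b ≤ i + 1 := by
        intro b hb
        rcases List.mem_append.1 hb with hb | hb
        · exact (hgle b hb).trans (Nat.le_succ i)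
        · exact (List.eq_of_mem_replicate hb).le
      refine ⟨g ++ List.replicate n (i + 1), hg.append_replicate
        (fun b hb => (hgle b hb).trans (Nat.le_succ i)) (by omega) hi ?_, hb, ?_⟩
      · rw [← hn]
        exact stepsTo_lt _ _
      · intro k h1 h2
        rcases Nat.lt_or_ge i k with h | h
        · obtain rfl : k = i + 1 := by omega
          rw [residueUpTo_of_forall_le hb, ← mul_stepsTo (by omega) hi (s (i + 1)), hn,
            Nat.cast_add (stepsTo _ _ _), mul_add, mul_stepsTo (by omega) hi]
          simp
          ring
        · rw [← hgs k h1 h, residueUpTo, residueUpTo, List.filter_append,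
            (List.filter_eq_nil_iff (l := List.replicate n (i + 1))).2, List.append_nil]
          intro b hb
          have := List.eq_of_mem_replicate hb
          simp; omega
  have hp2 := hp.out.two_le
  obtain ⟨g, hg, -, hgs⟩ := build (p - 1) (by omega)
  refine ⟨g, hg, fun i h1 h2 t => ?_⟩
  rw [hgs i h1 (by omega)]
  exact hs i t

theorem IsLabelSequence.ext {g h : List ℕ} (hg : IsLabelSequence p g) (hh : IsLabelSequence p h)
    (H : ∀ i, 1 ≤ i → i < p → residueUpTo p g i = residueUpTo p h i) : g = h := by
  refine List.Perm.eq_of_pairwise' hg.pairwise_le hh.pairwise_le ?_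
  · rw [List.perm_iff_count]
    intro a
    by_cases ha : 1 ≤ a ∧ a < p
    · obtain ⟨i, rfl⟩ : ∃ i, a = i + 1 := ⟨a - 1, by omega⟩
      have e1 := hg.stepsTo_add_count i
      have e2 := hh.stepsTo_add_count i
      rw [H (i + 1) ha.1 ha.2] at e1
      have : residueUpTo p g i = residueUpTo p h i := by
        rcases Nat.eq_zero_or_pos i with rfl | h0
        · rw [hg.residueUpTo_zero, hh.residueUpTo_zero]
        · exact H i h0 (by omega)
      rw [this] at e1
      omega
    · rw [List.count_eq_zero_of_not_mem fun hm => ha ⟨hg.one_le a hm, hg.lt a hm⟩,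
        List.count_eq_zero_of_not_mem fun hm => ha ⟨hh.one_le a hm, hh.lt a hm⟩]

/-! ### Comparison with an optimal walk -/

/-- The hypotheses on `c` say that the line through `(i, c i)` and `(i + 1, c (i + 1))` is
nonnegative at `0` and at `p`: it has the values `p * β i / m` and `p * α i / m` there. Then each
passage contributes to the sum over `c` a nonnegative combination of its gaps and beads. -/
theorem IsOptimalLabels.sum_map_le {w v : List ℕ} (hw : IsLabelSequence p w)
    (ho : IsOptimalLabels p w) (hv : IsLabelSequence p v) {c α β : ℕ → ℤ} {m : ℤ} (hm : 0 < m)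
    (hα : ∀ i, 1 ≤ i → i < p → 0 ≤ α i) (hβ : ∀ i, 1 ≤ i → i < p → 0 ≤ β i)
    (hc : ∀ i, 1 ≤ i → i < p → m * c i = α i * i + β i * (p - i))
    (hc' : ∀ i, 1 ≤ i → i < p → m * c (i + 1) = α i * (i + 1) + β i * (p - (i + 1))) :
    (v.map c).sum ≤ (w.map c).sum ∧
      ((∀ i, 1 ≤ i → i < p → 0 < β i) → (∀ i, 1 ≤ i → i + 1 < p → 0 < α i) →
        (v.map c).sum = (w.map c).sum → v = w) := by
  rw [hv.sum_map_eq, hw.sum_map_eq]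
  have key : ∀ i, 1 ≤ i → i < p → ∀ s : ZMod p,
      m * (c i * stepsTo p i s - c (i + 1) * stepsTo p (i + 1) s) =
        α i * (i * stepsTo p i s - (i + 1) * stepsTo p (i + 1) s) +
        β i * ((p - i) * stepsTo p i s - (p - (i + 1)) * stepsTo p (i + 1) s) := by
    intro i h1 h2 s
    linear_combination (stepsTo p i s : ℤ) * hc i h1 h2 - (stepsTo p (i + 1) s : ℤ) * hc' i h1 h2
  have hterm : ∀ k ∈ Finset.range (p - 1),
      (c (k + 1) * stepsTo p (k + 1) (residueUpTo p v (k + 1)) -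
        c (k + 2) * stepsTo p (k + 2) (residueUpTo p v (k + 1))) ≤
      (c (k + 1) * stepsTo p (k + 1) (residueUpTo p w (k + 1)) -
        c (k + 2) * stepsTo p (k + 2) (residueUpTo p w (k + 1))) := by
    intro k hk
    have hk : k + 1 < p := by have := Finset.mem_range.1 hk; omega
    refine le_of_mul_le_mul_left ?_ hm
    have hgain := ho (k + 1) (by omega) hk (residueUpTo p v (k + 1))
    rw [key (k + 1) (by omega) hk, key (k + 1) (by omega) hk]
    exact add_le_add
      (mul_le_mul_of_nonneg_left (gaps_le_of_switchGain_le (by omega) hk hgain)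
        (hα _ (by omega) hk))
      (mul_le_mul_of_nonneg_left (beads_le_of_switchGain_le (by omega) hk hgain)
        (hβ _ (by omega) hk))
  refine ⟨Finset.sum_le_sum hterm, fun hβ' hα' heq => hv.ext hw fun i h1 h2 => ?_⟩
  have heq := (Finset.sum_eq_sum_iff_of_le hterm).1 heq
  obtain ⟨k, rfl⟩ : ∃ k, i = k + 1 := ⟨i - 1, by omega⟩
  have e := congrArg (m * ·) (heq k (Finset.mem_range.2 (by omega)))
  simp only [key (k + 1) h1 h2] at e
  have hgain := ho (k + 1) (by omega) h2 (residueUpTo p v (k + 1))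
  have hF := gaps_le_of_switchGain_le h1 h2 hgain
  have hH := beads_le_of_switchGain_le h1 h2 hgain
  set F := ((k + 1 : ℕ) * stepsTo p (k + 1) (residueUpTo p v (k + 1)) -
    ((k + 1 : ℕ) + 1) * stepsTo p (k + 1 + 1) (residueUpTo p v (k + 1)) : ℤ) with hFd
  set F' := ((k + 1 : ℕ) * stepsTo p (k + 1) (residueUpTo p w (k + 1)) -
    ((k + 1 : ℕ) + 1) * stepsTo p (k + 1 + 1) (residueUpTo p w (k + 1)) : ℤ) with hFd'
  set H := ((p - (k + 1 : ℕ)) * stepsTo p (k + 1) (residueUpTo p v (k + 1)) -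
    (p - ((k + 1 : ℕ) + 1)) * stepsTo p (k + 1 + 1) (residueUpTo p v (k + 1)) : ℤ) with hHd
  set H' := ((p - (k + 1 : ℕ)) * stepsTo p (k + 1) (residueUpTo p w (k + 1)) -
    (p - ((k + 1 : ℕ) + 1)) * stepsTo p (k + 1 + 1) (residueUpTo p w (k + 1)) : ℤ) with hHd'
  have hFm := mul_le_mul_of_nonneg_left hF (hα _ h1 h2)
  have hHm := mul_le_mul_of_nonneg_left hH (hβ _ h1 h2)
  have eH : H = H' := mul_left_cancel₀ (hβ' _ h1 h2).ne' (by linarith)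
  apply switchGain_injective h1 h2
  have hp0 : (p : ℤ) ≠ 0 := by exact_mod_cast hp.out.ne_zero
  rcases Nat.lt_or_ge (k + 1 + 1) p with hi | hi
  · have eF : F = F' := mul_left_cancel₀ (hα' _ h1 hi).ne' (by linarith)
    apply mul_left_cancel₀ hp0
    have : ∀ s, (p : ℤ) * switchGain p (k + 1) s =
      ((k + 1 : ℕ) * stepsTo p (k + 1) s - ((k + 1 : ℕ) + 1) * stepsTo p (k + 1 + 1) s) +
      ((p - (k + 1 : ℕ)) * stepsTo p (k + 1) s -
        (p - ((k + 1 : ℕ) + 1)) * stepsTo p (k + 1 + 1) s) := by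
      intro s; unfold switchGain; ring
    rw [this, this, ← hFd, ← hFd', ← hHd, ← hHd', eF, eH]
  · have hk : p = k + 1 + 1 := by omega
    have hk' : (p : ℤ) - (k + 1 : ℕ) = 1 := by omega
    have e0 : ∀ s, stepsTo p (k + 1 + 1) s = 0 := fun s => by
      conv_lhs => rw [← hk]
      exact stepsTo_self s
    unfold switchGain
    rw [hHd, hHd', hk', e0, e0] at eH
    rw [e0, e0]
    linarith

theorem IsOptimalLabels.length_le {w v : List ℕ} (hw : IsLabelSequence p w)
    (ho : IsOptimalLabels p w) (hv : IsLabelSequence p v) :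
    v.length ≤ w.length ∧ (v.length = w.length → v = w) := by
  have hp0 : (0 : ℤ) < p := by exact_mod_cast hp.out.pos
  have := ho.sum_map_le hw hv (c := fun _ => 1) (α := fun _ => 1) (β := fun _ => 1) hp0
    (by simp) (by simp) (by intros; ring) (by intros; ring)
  simp only [List.map_const', List.sum_replicate, nsmul_eq_mul, mul_one] at this
  exact ⟨by exact_mod_cast this.1, fun h => this.2 (by simp) (by simp) (by exact_mod_cast h)⟩

/-- For a fixed `b` the kernel is piecewise linear and concave in the other label, and vanishes at `0`
and `p`. -/
theorem IsOptimalLabels.sum_labelKernel_le {w v : List ℕ} (hw : IsLabelSequence p w)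
    (ho : IsOptimalLabels p w) (hv : IsLabelSequence p v) {b : ℕ} (hb : b < p) :
    (v.map fun a => labelKernel p a b).sum ≤ (w.map fun a => labelKernel p a b).sum := by
  refine (ho.sum_map_le hw hv (m := 1) (α := fun i => if i < b then (p : ℤ) - b else 0)
    (β := fun i => if i < b then 0 else b) one_pos ?_ ?_ ?_ ?_).1
  · intro i _ _; split_ifs <;> omega
  · intro i _ _; split_ifs <;> omega
  · intro i _ _; split_ifs with h
    · rw [labelKernel_of_le p h.le]; ring
    · rw [labelKernel_comm, labelKernel_of_le p (not_lt.1 h)]; ring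
  · intro i _ _; split_ifs with h
    · rw [labelKernel_of_le p h]; push_cast; ring
    · rw [labelKernel_comm, labelKernel_of_le p (by omega)]; push_cast; ring

theorem IsOptimalLabels.sizeOfLabels_le {w v : List ℕ} (hw : IsLabelSequence p w)
    (ho : IsOptimalLabels p w) (hv : IsLabelSequence p v) :
    sizeOfLabels p v ≤ sizeOfLabels p w ∧ (sizeOfLabels p v = sizeOfLabels p w → v = w) := by
  have hp0 : (0 : ℤ) < p := by exact_mod_cast hp.out.pos
  have hdiag := ho.sum_map_le hw hv (c := fun a => labelKernel p a a) (m := p)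
    (α := fun i => (p - i) * (p - (i + 1))) (β := fun i => i * (i + 1)) hp0
    (fun i _ h => mul_nonneg (by omega) (by omega)) (fun i _ _ => by positivity)
    (fun i _ _ => by rw [labelKernel_of_le p le_rfl]; ring)
    (fun i _ _ => by rw [labelKernel_of_le p le_rfl]; push_cast; ring)
  have hstrict := hdiag.2 (fun i _ _ => by positivity)
    (fun i _ _ => mul_pos (by omega) (by omega))
  have ev := hv.two_mul_sizeOfLabels
  have ew := hw.two_mul_sizeOfLabels
  -- The kernel is symmetric, so the mixed term of `v` and `w` can be read from both sides.
  have h1 : (v.map fun a => (v.map fun b => labelKernel p b a).sum).sum ≤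
      (v.map fun a => (w.map fun b => labelKernel p b a).sum).sum :=
    List.sum_le_sum fun a ha => ho.sum_labelKernel_le hw hv (hv.lt a ha)
  have h2 : (w.map fun a => (v.map fun b => labelKernel p b a).sum).sum ≤
      (w.map fun a => (w.map fun b => labelKernel p b a).sum).sum :=
    List.sum_le_sum fun a ha => ho.sum_labelKernel_le hw hv (hw.lt a ha)
  have h3 : (w.map fun a => (v.map fun b => labelKernel p b a).sum).sum =
      (v.map fun a => (w.map fun b => labelKernel p b a).sum).sum := by
    rw [sum_map_sum_map_comm]
    simp only [fun a b => labelKernel_comm p a b]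
  have hd := hdiag.1
  exact ⟨by omega, fun h => hstrict (by omega)⟩

end

/-! ### Walks and their labels -/

/-- The vertices visited by a chain of edges are the partial sums of its labels. -/
theorem map_target_eq_map_range {p : ℕ} (E : List (ResidueEdge p)) (r : ZMod p)
    (hr : ∀ e ∈ E.head?, e.source = r) (hc : E.IsChain fun e f => e.target = f.source) :
    E.map ResidueEdge.target = (List.range E.length).map fun j =>
      r + ((((E.map ResidueEdge.label).take (j + 1)).sum : ℕ) : ZMod p) := by
  induction E generalizing r with
  | nil => simp
  | cons e E ih =>
    have he : e.source = r := hr e (by simp)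
    have ht : ∀ f ∈ E.head?, f.source = e.target := fun f hf => by
      cases E with
      | nil => simp at hf
      | cons f' E =>
        simp only [List.head?_cons, Option.mem_some] at hf
        subst hf
        exact (List.isChain_cons_cons.1 hc).1.symm
    rw [List.map_cons, ih _ ht hc.of_cons, List.length_cons, List.range_succ_eq_map, List.map_cons,
      List.map_map]
    congr 1
    · simp [ResidueEdge.target, he]
    · refine List.map_congr_left fun j _ => ?_
      simp [ResidueEdge.target, he, add_assoc]

theorem eq_of_map_label_eq {p : ℕ} (E F : List (ResidueEdge p)) (r : ZMod p)
    (hE : ∀ e ∈ E.head?, e.source = r) (hF : ∀ e ∈ F.head?, e.source = r)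
    (cE : E.IsChain fun e f => e.target = f.source)
    (cF : F.IsChain fun e f => e.target = f.source)
    (h : E.map ResidueEdge.label = F.map ResidueEdge.label) : E = F := by
  induction E generalizing r F with
  | nil => simpa using h
  | cons e E ih =>
    cases F with
    | nil => simp at h
    | cons f F =>
      simp only [List.map_cons, List.cons.injEq] at h
      have hef : e = f := by
        have h1 := hE e (by simp)
        have h2 := hF f (by simp)
        cases e; cases f
        simp_all
      subst hef
      rw [ih F e.target _ _ cE.of_cons cF.of_cons h.2]
      · intro g hg
        cases E with
        | nil => simp at hg
        | cons f' E =>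
          simp only [List.head?_cons, Option.mem_some] at hg
          subst hg
          exact (List.isChain_cons_cons.1 cE).1.symm
      · intro g hg
        cases F with
        | nil => simp at hg
        | cons f' E =>
          simp only [List.head?_cons, Option.mem_some] at hg
          subst hg
          exact (List.isChain_cons_cons.1 cF).1.symm

theorem exists_edges_map_label_eq {p : ℕ} (g : List ℕ) (h1 : ∀ a ∈ g, 1 ≤ a)
    (h2 : ∀ a ∈ g, a ≤ p - 1) (r : ZMod p) :
    ∃ E : List (ResidueEdge p), (∀ e ∈ E.head?, e.source = r) ∧
      (E.IsChain fun e f => e.target = f.source) ∧ E.map ResidueEdge.label = g := by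
  induction g generalizing r with
  | nil => exact ⟨[], by simp, List.IsChain.nil, rfl⟩
  | cons a g ih =>
    obtain ⟨E, hE, hc, hl⟩ := ih (fun b hb => h1 b (by simp [hb]))
      (fun b hb => h2 b (by simp [hb])) (r + a)
    refine ⟨⟨r, a, h1 a (by simp), h2 a (by simp)⟩ :: E, by simp, ?_, by simp [hl]⟩
    cases E with
    | nil => exact List.isChain_singleton _
    | cons e E => exact List.isChain_cons_cons.2 ⟨(hE e (by simp)).symm, hc⟩

/-- The labels of the edges of a walk, in order. -/
def ResidueWalk.labels {p : ℕ} (w : ResidueWalk p) : List ℕ := w.edges.map ResidueEdge.label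

theorem ResidueWalk.length_labels {p : ℕ} (w : ResidueWalk p) : w.labels.length = w.length := by
  simp [labels, length]

theorem ResidueWalk.visited_eq {p : ℕ} (w : ResidueWalk p) :
    w.visited = (List.range w.labels.length).map fun j =>
      (((w.labels.take (j + 1)).sum : ℕ) : ZMod p) := by
  rw [visited, map_target_eq_map_range w.edges 0 w.starts_at_zero w.consecutive]
  simp [labels]

theorem ResidueWalk.labels_injective {p : ℕ} {v w : ResidueWalk p} (h : v.labels = w.labels) :
    v = w := by
  have := eq_of_map_label_eq v.edges w.edges 0 v.starts_at_zero w.starts_at_zero v.consecutive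
    w.consecutive h
  cases v; cases w
  simp_all

theorem ResidueWalk.isLabelSequence_labels {p : ℕ} (hp : 0 < p) (w : ResidueWalk p) :
    IsLabelSequence p w.labels := by
  refine ⟨?_, ?_, ?_, fun j hj hdvd => ?_⟩
  · rw [← List.isChain_iff_pairwise, labels, List.isChain_map]
    exact w.labels_increasing
  · intro a ha
    obtain ⟨e, -, rfl⟩ := List.mem_map.1 ha
    exact e.one_le_label
  · intro a ha
    obtain ⟨e, -, rfl⟩ := List.mem_map.1 ha
    have := e.label_le
    omega
  · have hm : (((w.labels.take (j + 1)).sum : ℕ) : ZMod p) ∈ w.visited := by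
      rw [visited_eq]
      exact List.mem_map.2 ⟨j, List.mem_range.2 hj, rfl⟩
    obtain ⟨e, he, h⟩ := List.mem_map.1 hm
    exact w.avoids_zero e he (h.trans ((ZMod.natCast_eq_zero_iff _ _).2 hdvd))

theorem IsLabelSequence.exists_walk {p : ℕ} {g : List ℕ} (hg : IsLabelSequence p g) :
    ∃ w : ResidueWalk p, w.labels = g := by
  obtain ⟨E, hs, hc, rfl⟩ := exists_edges_map_label_eq (p := p) g hg.one_le
    (fun a ha => by have := hg.lt a ha; omega) 0
  refine ⟨⟨E, hs, hc, ?_, fun e he h0 => ?_⟩, rfl⟩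
  · have := hg.pairwise_le
    rwa [← List.isChain_iff_pairwise, List.isChain_map] at this
  · have hm : e.target ∈ E.map ResidueEdge.target := List.mem_map.2 ⟨e, he, rfl⟩
    rw [map_target_eq_map_range E 0 hs hc, h0] at hm
    obtain ⟨j, hj, h⟩ := List.mem_map.1 hm
    rw [zero_add, ZMod.natCast_eq_zero_iff] at h
    exact hg.not_dvd j (by simpa using hj) h

/-! ### Partitions and their beads -/

/-- The number of gaps in positions before `n`, for beads in the positions of `B`. -/
def gapsBelow (B : Finset ℕ) (n : ℕ) : ℕ := ((Finset.range n).filter fun m => m ∉ B).card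

theorem gapsBefore_eq (μ : YoungDiagram) (n : ℕ) : gapsBefore μ n = gapsBelow (beads μ) n := rfl

theorem gapsBelow_zero (B : Finset ℕ) : gapsBelow B 0 = 0 := rfl

theorem gapsBelow_succ (B : Finset ℕ) (n : ℕ) :
    gapsBelow B (n + 1) = gapsBelow B n + if n ∈ B then 0 else 1 := by
  unfold gapsBelow
  rw [Finset.range_add_one, Finset.filter_insert]
  by_cases h : n ∈ B
  · simp [h]
  · simp [h, Finset.card_insert_of_notMem]

theorem gapsBelow_mono (B : Finset ℕ) : Monotone (gapsBelow B) :=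
  monotone_nat_of_le_succ fun n => by rw [gapsBelow_succ]; omega

theorem gapsBelow_lt_of_notMem {B : Finset ℕ} {m n : ℕ} (hm : m ∉ B) (h : m < n) :
    gapsBelow B m < gapsBelow B n := by
  have h1 := gapsBelow_mono B (Nat.succ_le_of_lt h)
  rw [Nat.succ_eq_add_one, gapsBelow_succ, if_neg hm] at h1
  omega

theorem gapsBelow_add_card (B : Finset ℕ) (n : ℕ) :
    gapsBelow B n + (B.filter (· < n)).card = n := by
  have e : B.filter (· < n) = (Finset.range n).filter fun m => ¬ m ∉ B := by
    ext m
    simp [and_comm]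
  rw [e, gapsBelow, Finset.card_filter_add_card_filter_not, Finset.card_range]

theorem card_filter_lt_of_image {B : Finset ℕ} {f : ℕ → ℕ} {l : ℕ}
    (hf : ∀ i j, i < j → j < l → f j < f i) (hB : B = (Finset.range l).image f) {k : ℕ}
    (hk : k < l) : (B.filter (· < f k)).card = l - (k + 1) := by
  have e : B.filter (· < f k) = (Finset.Ico (k + 1) l).image f := by
    ext n
    simp only [hB, Finset.mem_filter, Finset.mem_image, Finset.mem_range, Finset.mem_Ico]
    constructor
    · rintro ⟨⟨i, hi, rfl⟩, hlt⟩
      refine ⟨i, ⟨?_, hi⟩, rfl⟩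
      by_contra! h
      rcases Nat.lt_or_ge i k with h' | h'
      · have := hf i k h' hk; omega
      · have : i = k := by omega
        simp [this] at hlt
    · rintro ⟨i, ⟨h1, h2⟩, rfl⟩
      exact ⟨⟨i, h2, rfl⟩, hf k i (by omega) h2⟩
  rw [e, Finset.card_image_of_injOn, Nat.card_Ico]
  intro i hi j hj hij
  simp only [Finset.coe_Ico, Set.mem_Ico] at hi hj
  rcases lt_trichotomy i j with h | h | h
  · have := hf i j h hj.2; omega
  · exact h
  · have := hf j i h hi.2; omega

/-- The position of the bead of the `k`-th part. -/
def beadAt (μ : YoungDiagram) (k : ℕ) : ℕ := μ.rowLen k + (μ.colLen 0 - (k + 1))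

theorem beads_eq (μ : YoungDiagram) : beads μ = (Finset.range (μ.colLen 0)).image (beadAt μ) := rfl

theorem beadAt_lt (μ : YoungDiagram) (i j : ℕ) (h : i < j) (hj : j < μ.colLen 0) :
    beadAt μ j < beadAt μ i := by
  have := μ.rowLen_anti i j h.le
  unfold beadAt
  omega

theorem mem_beads {μ : YoungDiagram} {n : ℕ} :
    n ∈ beads μ ↔ ∃ k < μ.colLen 0, beadAt μ k = n := by
  simp [beads_eq]

theorem gapsBelow_beadAt (μ : YoungDiagram) {k : ℕ} (hk : k < μ.colLen 0) :
    gapsBelow (beads μ) (beadAt μ k) = μ.rowLen k := by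
  have h1 := gapsBelow_add_card (beads μ) (beadAt μ k)
  rw [card_filter_lt_of_image (beadAt_lt μ) (beads_eq μ) hk] at h1
  unfold beadAt at *
  omega

/-- The position of the gap with `j` gaps before it. -/
def gapAt (μ : YoungDiagram) (j : ℕ) : ℕ := j + (μ.colLen 0 - μ.colLen j)

theorem beadAt_lt_gapAt_iff (μ : YoungDiagram) {j k : ℕ} (hk : k < μ.colLen 0) :
    (beadAt μ k < gapAt μ j ↔ μ.colLen j ≤ k) ∧ beadAt μ k ≠ gapAt μ j := by
  have h0 := μ.colLen_anti 0 j (Nat.zero_le _)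
  have hiff : j < μ.rowLen k ↔ k < μ.colLen j := by
    rw [← YoungDiagram.mem_iff_lt_rowLen, YoungDiagram.mem_iff_lt_colLen]
  unfold beadAt gapAt
  omega

theorem gapAt_notMem (μ : YoungDiagram) (j : ℕ) : gapAt μ j ∉ beads μ := fun h => by
  obtain ⟨k, hk, h⟩ := mem_beads.1 h
  exact (beadAt_lt_gapAt_iff μ hk).2 h

theorem gapsBelow_gapAt (μ : YoungDiagram) (j : ℕ) : gapsBelow (beads μ) (gapAt μ j) = j := by
  have h0 := μ.colLen_anti 0 j (Nat.zero_le _)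
  have h1 := gapsBelow_add_card (beads μ) (gapAt μ j)
  have e : (beads μ).filter (· < gapAt μ j) =
      (Finset.Ico (μ.colLen j) (μ.colLen 0)).image (beadAt μ) := by
    ext n
    simp only [beads_eq, Finset.mem_filter, Finset.mem_image, Finset.mem_range, Finset.mem_Ico]
    constructor
    · rintro ⟨⟨k, hk, rfl⟩, hlt⟩
      exact ⟨k, ⟨(beadAt_lt_gapAt_iff μ hk).1.1 hlt, hk⟩, rfl⟩
    · rintro ⟨k, ⟨h1, hk⟩, rfl⟩
      exact ⟨⟨k, hk, rfl⟩, (beadAt_lt_gapAt_iff μ hk).1.2 h1⟩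
  rw [e, Finset.card_image_of_injOn, Nat.card_Ico] at h1
  · unfold gapAt at *
    omega
  · intro i hi j hj hij
    simp only [Finset.coe_Ico, Set.mem_Ico] at hi hj
    rcases lt_trichotomy i j with h | h | h
    · have := beadAt_lt μ i j h hj.2; omega
    · exact h
    · have := beadAt_lt μ j i h hi.2; omega

/-- The hook lengths are the distances from the beads back to the gaps before them. -/
theorem hookLength_eq {μ : YoungDiagram} {i j : ℕ} (h : (i, j) ∈ μ) :
    gapAt μ j < beadAt μ i ∧ hookLength μ i j = beadAt μ i - gapAt μ j := by
  have h0 := μ.colLen_anti 0 j (Nat.zero_le _)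
  have h1 := YoungDiagram.mem_iff_lt_rowLen.1 h
  have h2 := YoungDiagram.mem_iff_lt_colLen.1 h
  unfold hookLength gapAt beadAt
  omega

/-- In a `p`-core, no gap lies a multiple of `p` before a bead. -/
theorem isCorePartition_iff {p : ℕ} {μ : YoungDiagram} :
    IsCorePartition p μ ↔ ∀ n ∈ beads μ, ∀ m < n, m ∉ beads μ → ¬ p ∣ n - m := by
  constructor
  · intro h n hn m hlt hm
    obtain ⟨i, hi, rfl⟩ := mem_beads.1 hn
    have hmem : (i, gapsBelow (beads μ) m) ∈ μ := by
      rw [YoungDiagram.mem_iff_lt_rowLen, ← gapsBelow_beadAt μ hi]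
      exact gapsBelow_lt_of_notMem hm hlt
    have e : gapAt μ (gapsBelow (beads μ) m) = m := by
      have := gapsBelow_gapAt μ (gapsBelow (beads μ) m)
      rcases lt_trichotomy (gapAt μ (gapsBelow (beads μ) m)) m with h | h | h
      · have := gapsBelow_lt_of_notMem (gapAt_notMem μ _) h; omega
      · exact h
      · have := gapsBelow_lt_of_notMem hm h; omega
    have := h _ _ hmem
    rwa [(hookLength_eq hmem).2, e] at this
  · intro h i j hij
    have hi : i < μ.colLen 0 :=
      (YoungDiagram.mem_iff_lt_colLen.1 hij).trans_le (μ.colLen_anti 0 j (Nat.zero_le _))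
    obtain ⟨h1, h2⟩ := hookLength_eq hij
    rw [h2]
    exact h _ (mem_beads.2 ⟨i, hi, rfl⟩) _ h1 (gapAt_notMem μ j)

theorem isPrimePartition_iff {p : ℕ} {μ : YoungDiagram} :
    IsPrimePartition p μ ↔ ∀ n ∈ beads μ, ¬ p ∣ gapsBelow (beads μ) n := by
  unfold IsPrimePartition YoungDiagram.rowLens
  constructor
  · intro h n hn
    obtain ⟨k, hk, rfl⟩ := mem_beads.1 hn
    rw [gapsBelow_beadAt μ hk]
    exact h _ (List.mem_map.2 ⟨k, List.mem_range.2 hk, rfl⟩)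
  · intro h a ha
    obtain ⟨k, hk, rfl⟩ := List.mem_map.1 ha
    have hk := List.mem_range.1 hk
    rw [← gapsBelow_beadAt μ hk]
    exact h _ (mem_beads.2 ⟨k, hk, rfl⟩)

theorem card_eq_sum_gapsBelow (μ : YoungDiagram) :
    μ.card = ∑ n ∈ beads μ, gapsBelow (beads μ) n := by
  have h1 : μ.card = ∑ k ∈ Finset.range (μ.colLen 0), μ.rowLen k := by
    rw [YoungDiagram.card, Finset.card_eq_sum_card_fiberwise (f := Prod.fst)
      (t := Finset.range (μ.colLen 0))]
    · refine Finset.sum_congr rfl fun k _ => ?_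
      rw [YoungDiagram.rowLen_eq_card, YoungDiagram.row]
    · rintro ⟨i, j⟩ h
      have h : (i, j) ∈ μ := h
      simpa using (YoungDiagram.mem_iff_lt_colLen.1 h).trans_le (μ.colLen_anti 0 j (Nat.zero_le _))
  rw [h1]
  conv_rhs => rw [beads_eq]
  rw [Finset.sum_image]
  · exact Finset.sum_congr rfl fun k hk => (gapsBelow_beadAt μ (Finset.mem_range.1 hk)).symm
  · intro i hi j hj hij
    simp only [Finset.coe_range, Set.mem_Iio] at hi hj
    rcases lt_trichotomy i j with h | h | h
    · have := beadAt_lt μ i j h hj; omega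
    · exact h
    · have := beadAt_lt μ j i h hi; omega

theorem zero_notMem_beads (μ : YoungDiagram) : 0 ∉ beads μ := fun h => by
  obtain ⟨k, hk, h⟩ := mem_beads.1 h
  have := (YoungDiagram.mem_iff_lt_rowLen (j := 0)).1 (YoungDiagram.mem_iff_lt_colLen.2 hk)
  unfold beadAt at h
  omega

theorem rowLens_eq_map_sort (μ : YoungDiagram) :
    μ.rowLens = ((beads μ).sort (· ≥ ·)).map (gapsBelow (beads μ)) := by
  have e : (beads μ).sort (· ≥ ·) = (List.range (μ.colLen 0)).map (beadAt μ) := by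
    have hp : ((List.range (μ.colLen 0)).map (beadAt μ)).Pairwise (· > ·) := by
      rw [List.pairwise_map]
      exact List.pairwise_lt_range.imp_of_mem fun _ hb hab =>
        beadAt_lt μ _ _ hab (List.mem_range.1 hb)
    have hf : ((List.range (μ.colLen 0)).map (beadAt μ)).toFinset = beads μ := by
      ext n
      simp [mem_beads]
    rw [← hf, List.toFinset_sort (· ≥ ·) (hp.imp fun h => h.ne')]
    exact hp.imp fun h => h.le
  rw [e, List.map_map, YoungDiagram.rowLens]
  exact List.map_congr_left fun k hk => (gapsBelow_beadAt μ (List.mem_range.1 hk)).symm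

theorem beads_injective : Function.Injective beads := fun μ ν h => by
  have e : μ.rowLens = ν.rowLens := by rw [rowLens_eq_map_sort, rowLens_eq_map_sort, h]
  apply YoungDiagram.equivListRowLens.injective
  exact Subtype.ext e

theorem exists_beads_eq {B : Finset ℕ} (h0 : 0 ∉ B) : ∃ μ : YoungDiagram, beads μ = B := by
  set L := B.sort (· ≥ ·) with hL
  have hdec : L.Pairwise (· > ·) := (Finset.sortedGT_sort B).pairwise
  have hlen : L.length = B.card := Finset.length_sort _
  have hmem : ∀ n, n ∈ L ↔ n ∈ B := fun n => Finset.mem_sort _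
  have hsort : (L.map (gapsBelow B)).SortedGE := by
    refine List.Pairwise.sortedGE ?_
    rw [List.pairwise_map]
    exact hdec.imp fun h => gapsBelow_mono B h.le
  have hpos : ∀ x ∈ L.map (gapsBelow B), 0 < x := by
    intro x hx
    obtain ⟨n, hn, rfl⟩ := List.mem_map.1 hx
    have hn := (hmem n).1 hn
    have hn0 : 0 < n := Nat.pos_of_ne_zero fun h => h0 (h ▸ hn)
    exact (Nat.zero_le _).trans_lt (gapsBelow_lt_of_notMem h0 hn0)
  have hf : ∀ i j, i < j → j < L.length → L.getD j 0 < L.getD i 0 := by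
    intro i j hij hj
    rw [List.getD_eq_getElem _ _ hj, List.getD_eq_getElem _ _ (hij.trans hj)]
    exact List.pairwise_iff_getElem.1 hdec i j _ _ hij
  have hB : B = (Finset.range L.length).image fun k => L.getD k 0 := by
    ext n
    rw [← hmem, List.mem_iff_getElem]
    simp only [Finset.mem_image, Finset.mem_range]
    constructor
    · rintro ⟨k, hk, rfl⟩
      exact ⟨k, hk, List.getD_eq_getElem _ _ hk⟩
    · rintro ⟨k, hk, rfl⟩
      exact ⟨k, hk, (List.getD_eq_getElem _ _ hk).symm⟩
  refine ⟨YoungDiagram.ofRowLens _ hsort, ?_⟩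
  have hcol : (YoungDiagram.ofRowLens _ hsort).colLen 0 = L.length := by
    rw [← YoungDiagram.length_rowLens, YoungDiagram.rowLens_length_ofRowLens hpos, List.length_map]
  conv_rhs => rw [hB]
  rw [beads_eq, hcol]
  refine Finset.image_congr fun k hk => ?_
  have hk : k < L.length := by simpa using hk
  have h1 := gapsBelow_add_card B (L.getD k 0)
  rw [card_filter_lt_of_image hf hB hk] at h1
  have h2 := YoungDiagram.rowLen_ofRowLens (hw := hsort) ⟨k, by simpa using hk⟩
  simp only [Fin.getElem_fin, List.getElem_map] at h2
  rw [beadAt, hcol, h2, ← List.getD_eq_getElem _ 0 hk]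
  exact h1

/-! ### The abacus of a label sequence -/

/-- The positions of the beads on the `p`-abacus with `g.length` nonempty rows, the `j`-th of which
has all its gaps, `g[j]` in number, to the left of its beads. -/
def beadsOfLabels (p : ℕ) (g : List ℕ) : Finset ℕ :=
  (Finset.range (p * g.length)).filter fun n => g.getD (n / p) 0 ≤ n % p

theorem mem_beadsOfLabels {p : ℕ} (hp : 0 < p) {g : List ℕ} {n : ℕ} :
    n ∈ beadsOfLabels p g ↔ n / p < g.length ∧ g.getD (n / p) 0 ≤ n % p := by
  rw [beadsOfLabels, Finset.mem_filter, Finset.mem_range, Nat.div_lt_iff_lt_mul hp, mul_comm]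

theorem mul_add_mem_beadsOfLabels {p : ℕ} {g : List ℕ} {j x : ℕ} (hx : x < p) :
    j * p + x ∈ beadsOfLabels p g ↔ j < g.length ∧ g.getD j 0 ≤ x := by
  have hp : 0 < p := by omega
  rw [mem_beadsOfLabels hp, mul_comm, Nat.mul_add_div hp, Nat.mul_add_mod, Nat.div_eq_of_lt hx,
    Nat.mod_eq_of_lt hx, add_zero]

theorem mem_beadsOfLabels_append_singleton {p : ℕ} (hp : 0 < p) {g : List ℕ} {a n : ℕ} :
    n ∈ beadsOfLabels p (g ++ [a]) ↔
      n ∈ beadsOfLabels p g ∨ (n / p = g.length ∧ a ≤ n % p) := by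
  rw [mem_beadsOfLabels hp, mem_beadsOfLabels hp]
  rcases lt_trichotomy (n / p) g.length with h | h | h
  · rw [List.getD_append _ _ _ _ h]
    simp [h, h.ne]
    omega
  · simp [h]
  · simp
    omega

theorem sum_take_succ_eq (g : List ℕ) {j : ℕ} (hj : j < g.length) :
    (g.take (j + 1)).sum = (g.take j).sum + g.getD j 0 := by
  rw [List.take_succ_eq_append_getElem hj, List.sum_append, List.sum_singleton,
    List.getD_eq_getElem _ _ hj]

section

variable {p : ℕ} {g : List ℕ}

theorem IsLabelSequence.getD_pos (hg : IsLabelSequence p g) {j : ℕ} (hj : j < g.length) :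
    0 < g.getD j 0 ∧ g.getD j 0 < p := by
  rw [List.getD_eq_getElem _ _ hj]
  exact ⟨hg.one_le _ (List.getElem_mem hj), hg.lt _ (List.getElem_mem hj)⟩

theorem IsLabelSequence.gapsBelow_add (hg : IsLabelSequence p g) {j x : ℕ} (hj : j < g.length)
    (hx : x ≤ p) :
    gapsBelow (beadsOfLabels p g) (j * p + x) = (g.take j).sum + min x (g.getD j 0) := by
  induction j generalizing x with
  | zero =>
    induction x with
    | zero => simp [gapsBelow_zero]
    | succ x ih =>
      have hmem := mul_add_mem_beadsOfLabels (g := g) (j := 0) (show x < p by omega)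
      rw [← add_assoc, gapsBelow_succ, ih (by omega)]
      split_ifs with h
      · have := (hmem.1 h).2
        omega
      · have : ¬ g.getD 0 0 ≤ x := fun h' => h (hmem.2 ⟨hj, h'⟩)
        omega
  | succ j ihj =>
    induction x with
    | zero =>
      rw [add_zero, Nat.succ_mul, ihj (by omega) le_rfl, sum_take_succ_eq g (by omega)]
      have := (hg.getD_pos (j := j) (by omega)).2
      omega
    | succ x ih =>
      have hmem := mul_add_mem_beadsOfLabels (g := g) (j := j + 1) (show x < p by omega)
      rw [← add_assoc, gapsBelow_succ, ih (by omega)]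
      split_ifs with h
      · have := (hmem.1 h).2
        omega
      · have : ¬ g.getD (j + 1) 0 ≤ x := fun h' => h (hmem.2 ⟨hj, h'⟩)
        omega

theorem IsLabelSequence.gapsBelow_of_getD_le (hg : IsLabelSequence p g) {j x : ℕ}
    (hj : j < g.length) (hx : x ≤ p) (h : g.getD j 0 ≤ x) :
    gapsBelow (beadsOfLabels p g) (j * p + x) = (g.take (j + 1)).sum := by
  rw [hg.gapsBelow_add hj hx, sum_take_succ_eq g hj, min_eq_right h]

theorem IsLabelSequence.not_dvd_gapsBelow (hg : IsLabelSequence p g) (hp : 0 < p) {n : ℕ}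
    (hn : n ∈ beadsOfLabels p g) : ¬ p ∣ gapsBelow (beadsOfLabels p g) n := by
  obtain ⟨h1, h2⟩ := (mem_beadsOfLabels hp).1 hn
  have := hg.gapsBelow_of_getD_le h1 (Nat.mod_lt n hp).le h2
  rw [Nat.div_add_mod'] at this
  rw [this]
  exact hg.not_dvd _ h1

theorem IsLabelSequence.sub_mem_beadsOfLabels (hg : IsLabelSequence p g) (hp : 0 < p) {n m : ℕ}
    (hn : n ∈ beadsOfLabels p g) (hmn : m < n) (hdvd : p ∣ n - m) : m ∈ beadsOfLabels p g := by
  rw [mem_beadsOfLabels hp] at hn ⊢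
  have hmod : m % p = n % p := (Nat.modEq_iff_dvd' hmn.le).2 hdvd
  have hdiv : m / p ≤ n / p := Nat.div_le_div_right hmn.le
  refine ⟨by omega, ?_⟩
  rw [hmod]
  refine le_trans ?_ hn.2
  rw [List.getD_eq_getElem _ _ hn.1, List.getD_eq_getElem _ _ (hdiv.trans_lt hn.1)]
  rcases hdiv.eq_or_lt with h | h
  · simp [h]
  · exact List.pairwise_iff_getElem.1 hg.pairwise_le _ _ _ _ h

theorem IsLabelSequence.sum_gapsBelow (hg : IsLabelSequence p g) (hp : 0 < p) :
    ∑ n ∈ beadsOfLabels p g, gapsBelow (beadsOfLabels p g) n = sizeOfLabels p g := by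
  rw [sizeOfLabels, ← Finset.sum_fiberwise_of_maps_to (g := fun n => n / p)
    (t := Finset.range g.length)
    fun n hn => Finset.mem_range.2 ((mem_beadsOfLabels hp).1 hn).1]
  refine Finset.sum_congr rfl fun j hj => ?_
  have hj := Finset.mem_range.1 hj
  have e : (beadsOfLabels p g).filter (fun n => n / p = j) =
      (Finset.Ico (g.getD j 0) p).image (j * p + ·) := by
    ext n
    simp only [Finset.mem_filter, Finset.mem_image, Finset.mem_Ico]
    constructor
    · rintro ⟨hn, rfl⟩
      exact ⟨n % p, ⟨((mem_beadsOfLabels hp).1 hn).2, Nat.mod_lt n hp⟩, Nat.div_add_mod' n p⟩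
    · rintro ⟨x, ⟨h1, h2⟩, rfl⟩
      refine ⟨(mul_add_mem_beadsOfLabels h2).2 ⟨hj, h1⟩, ?_⟩
      rw [mul_comm, Nat.mul_add_div hp, Nat.div_eq_of_lt h2, add_zero]
  rw [e, Finset.sum_image (by intro a _ b _ h; simpa using h),
    Finset.sum_congr rfl (g := fun _ => (g.take (j + 1)).sum), Finset.sum_const, Nat.card_Ico,
    smul_eq_mul]
  intro x hx
  have hx := Finset.mem_Ico.1 hx
  exact hg.gapsBelow_of_getD_le hj hx.2.le hx.1

theorem IsLabelSequence.isCorePartition (hg : IsLabelSequence p g) (hp : 0 < p)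
    {μ : YoungDiagram} (hμ : beads μ = beadsOfLabels p g) : IsCorePartition p μ := by
  rw [isCorePartition_iff, hμ]
  exact fun n hn m hlt hm hdvd => hm (hg.sub_mem_beadsOfLabels hp hn hlt hdvd)

theorem IsLabelSequence.isPrimePartition (hg : IsLabelSequence p g) (hp : 0 < p)
    {μ : YoungDiagram} (hμ : beads μ = beadsOfLabels p g) : IsPrimePartition p μ := by
  rw [isPrimePartition_iff, hμ]
  exact fun n hn => hg.not_dvd_gapsBelow hp hn

theorem IsLabelSequence.zero_notMem (hg : IsLabelSequence p g) (hp : 0 < p) :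
    0 ∉ beadsOfLabels p g := by
  rw [mem_beadsOfLabels hp]
  rintro ⟨h1, h2⟩
  have := (hg.getD_pos h1).1
  simp at h2 this
  omega

theorem beadsRightmost_of_beads_eq (hp : 0 < p) {μ : YoungDiagram}
    (hμ : beads μ = beadsOfLabels p g) : BeadsRightmost p μ := by
  intro n hn hlt
  rw [hμ] at hn ⊢
  obtain ⟨h1, h2⟩ := (mem_beadsOfLabels hp).1 hn
  have := (mul_add_mem_beadsOfLabels (g := g) (j := n / p) hlt).2 ⟨h1, by omega⟩
  rwa [← add_assoc, Nat.div_add_mod'] at this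

theorem IsLabelSequence.abacusResidueSequence_eq (hg : IsLabelSequence p g) (hp : 0 < p)
    {μ : YoungDiagram} (hμ : beads μ = beadsOfLabels p g) :
    abacusResidueSequence p μ =
      (List.range g.length).map fun j => (((g.take (j + 1)).sum : ℕ) : ZMod p) := by
  have e : (beads μ).image (fun n => n / p) = Finset.range g.length := by
    ext j
    rw [hμ, Finset.mem_image, Finset.mem_range]
    constructor
    · rintro ⟨n, hn, rfl⟩
      exact ((mem_beadsOfLabels hp).1 hn).1
    · intro hj
      have := (hg.getD_pos hj).2
      refine ⟨j * p + (p - 1), (mul_add_mem_beadsOfLabels (by omega)).2 ⟨hj, by omega⟩, ?_⟩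
      rw [mul_comm, Nat.mul_add_div hp, Nat.div_eq_of_lt (by omega), add_zero]
  rw [abacusResidueSequence, beadRows, e, Finset.sort_range]
  refine List.map_congr_left fun j hj => ?_
  have hj := List.mem_range.1 hj
  have := (hg.getD_pos hj).2
  rw [gapsBefore_eq, hμ, hg.gapsBelow_of_getD_le hj (by omega) (by omega)]

end

/-! ### The label sequence of a core -/

theorem sum_filter_lt_eq_add (B : Finset ℕ) {a b : ℕ} (hab : a ≤ b) (f : ℕ → ℕ) :
    ∑ n ∈ B.filter (· < b), f n =
      ∑ n ∈ B.filter (· < a), f n + ∑ n ∈ B.filter (fun n => a ≤ n ∧ n < b), f n := by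
  rw [← Finset.sum_union]
  · congr 1
    ext n
    simp only [Finset.mem_filter, Finset.mem_union]
    rw [← and_or_left]
    refine and_congr_right fun _ => ?_
    omega
  · rw [Finset.disjoint_left]
    intro n h1 h2
    have := (Finset.mem_filter.1 h1).2
    have := (Finset.mem_filter.1 h2).2
    omega

theorem card_beads_add_gapsBelow (B : Finset ℕ) {a b : ℕ} (hab : a ≤ b) :
    (B.filter fun n => a ≤ n ∧ n < b).card + gapsBelow B b = b - a + gapsBelow B a := by
  have h1 := gapsBelow_add_card B a
  have h2 := gapsBelow_add_card B b
  have h3 := sum_filter_lt_eq_add B hab fun _ => 1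
  simp only [← Finset.card_eq_sum_ones] at h3
  omega

/-- The beads in the interval `[a, b)` contribute most if they are in its last positions. -/
theorem sum_gapsBelow_window_le (B : Finset ℕ) {a b l : ℕ} (hab : a ≤ b)
    (hl : gapsBelow B b = gapsBelow B a + l) :
    ∑ n ∈ B.filter (fun n => a ≤ n ∧ n < b), gapsBelow B n ≤ (b - a - l) * gapsBelow B b ∧
      (∑ n ∈ B.filter (fun n => a ≤ n ∧ n < b), gapsBelow B n = (b - a - l) * gapsBelow B b →
        ∀ n, a ≤ n → n < b → (n ∈ B ↔ a + l ≤ n)) := by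
  have hcard := card_beads_add_gapsBelow B hab
  have hcard : (B.filter fun n => a ≤ n ∧ n < b).card = b - a - l := by omega
  have hle : ∀ n ∈ B.filter (fun n => a ≤ n ∧ n < b), gapsBelow B n ≤ gapsBelow B b :=
    fun n hn => gapsBelow_mono B (Finset.mem_filter.1 hn).2.2.le
  have hconst : (b - a - l) * gapsBelow B b =
      ∑ n ∈ B.filter (fun n => a ≤ n ∧ n < b), gapsBelow B b := by
    rw [Finset.sum_const, hcard, smul_eq_mul]
  rw [hconst]
  refine ⟨Finset.sum_le_sum hle, fun h => ?_⟩
  have h := (Finset.sum_eq_sum_iff_of_le hle).1 h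
  have hsub : B.filter (fun n => a ≤ n ∧ n < b) ⊆ Finset.Ico (a + l) b := by
    intro n hn
    have hgap := h n hn
    have hn := (Finset.mem_filter.1 hn).2
    have := card_beads_add_gapsBelow B hn.1
    rw [Finset.mem_Ico]
    omega
  have heq := Finset.eq_of_subset_of_card_le hsub (by rw [Nat.card_Ico, hcard]; omega)
  intro n h1 h2
  have := Finset.ext_iff.1 heq n
  simp only [Finset.mem_filter, Finset.mem_Ico] at this
  tauto

/-- The number of gaps in the `p` positions before `b` (or in all of them, if `b < p`). -/
def windowGaps (p : ℕ) (B : Finset ℕ) (b : ℕ) : ℕ := gapsBelow B b - gapsBelow B (b - p)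

theorem windowGaps_le_windowGaps_add {p : ℕ} {B : Finset ℕ}
    (hcl : ∀ n, n + p ∈ B → n ∈ B) (b : ℕ) : windowGaps p B b ≤ windowGaps p B (b + p) := by
  have key : ∀ a d, gapsBelow B (a + d) - gapsBelow B a ≤
      gapsBelow B (a + p + d) - gapsBelow B (a + p) := by
    intro a d
    induction d with
    | zero => simp
    | succ d ih =>
      have h1 := gapsBelow_mono B (show a ≤ a + d by omega)
      have h2 := gapsBelow_mono B (show a + p ≤ a + p + d by omega)
      have h3 : a + d ∉ B → a + p + d ∉ B := fun h h' => h (hcl _ (by convert h' using 1; omega))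
      rw [← add_assoc, ← add_assoc, gapsBelow_succ, gapsBelow_succ]
      split_ifs with h4 h5 h5
      · omega
      · omega
      · exact absurd h5 (h3 h4)
      · omega
  unfold windowGaps
  rw [Nat.add_sub_cancel]
  rcases Nat.lt_or_ge b p with h | h
  · have := key 0 b
    rw [Nat.sub_eq_zero_of_le h.le, gapsBelow_zero]
    rw [gapsBelow_zero] at this
    have h1 := gapsBelow_mono B (show b ≤ p by omega)
    simp only [zero_add] at this
    rw [add_comm b p]
    omega
  · have := key (b - p) p
    rwa [Nat.sub_add_cancel h] at this

/-- Cut the abacus of a `p`-core after the last bead and then after every `p`-th position backwards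
from there. All the cuts come after a bead, so the numbers of gaps in the pieces are the labels of a
walk. Moving the beads to the ends of the pieces, and completing the first piece to `p` positions
by further beads, does not decrease the size. -/
theorem exists_labels_of_core {p : ℕ} {B : Finset ℕ} (h0 : 0 ∉ B)
    (hcl : ∀ n, n + p ∈ B → n ∈ B) (hpr : ∀ n ∈ B, ¬ p ∣ gapsBelow B n) {r : ℕ} (hr : r < p)
    (j : ℕ) (hj : j * p + r ∈ B) :
    ∃ g, IsLabelSequence p g ∧ g.length = j + 1 ∧ g.sum = gapsBelow B (j * p + r + 1) ∧
      (∀ a ∈ g, a ≤ windowGaps p B (j * p + r + 1)) ∧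
      ∑ n ∈ B.filter (· < j * p + r + 1), gapsBelow B n ≤ sizeOfLabels p g ∧
      (∑ n ∈ B.filter (· < j * p + r + 1), gapsBelow B n = sizeOfLabels p g →
        r + 1 = p ∧ B.filter (· < j * p + r + 1) = beadsOfLabels p g) := by
  have hp : 0 < p := by omega
  have hpos : ∀ n, 0 < gapsBelow B (n + 1) := fun n =>
    (Nat.zero_le _).trans_lt (gapsBelow_lt_of_notMem h0 (Nat.succ_pos n))
  induction j with
  | zero =>
    simp only [zero_mul, zero_add] at hj ⊢
    set l := gapsBelow B (r + 1) with hl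
    have hl' : l = gapsBelow B r := by rw [hl, gapsBelow_succ, if_pos hj, add_zero]
    have hlr : l ≤ r := by
      have := gapsBelow_add_card B r
      omega
    have hw := sum_gapsBelow_window_le B (a := 0) (b := r + 1) (l := l) (Nat.zero_le _)
      (by rw [gapsBelow_zero, zero_add])
    simp only [Nat.zero_le, true_and, Nat.sub_zero, zero_add, forall_const, ← hl] at hw
    have hsize : sizeOfLabels p [l] = (p - l) * l := by simp [sizeOfLabels]
    have hle : (r + 1 - l) * l ≤ (p - l) * l := Nat.mul_le_mul_right l (by omega)
    -- The first piece has `r + 1 - l` beads, which is at most `p - l`, with equality only if the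
    -- first cut is at the end of a row.
    refine ⟨[l], ?_, rfl, by simp, ?_, ?_, ?_⟩
    · have := isLabelSequence_append_singleton (p := p) (g := []) (a := l)
      refine this.2 ⟨IsLabelSequence.nil p, by simp, hpos r, by omega, ?_⟩
      rw [List.sum_nil, zero_add, hl']
      exact hpr r hj
    · intro a ha
      rw [List.mem_singleton] at ha
      rw [ha, windowGaps, Nat.sub_eq_zero_of_le (by omega : r + 1 ≤ p), gapsBelow_zero, ← hl]
      omega
    · rw [hsize]
      exact hw.1.trans hle
    · intro h
      rw [hsize] at h
      have h1 : (r + 1 - l) * l = (p - l) * l := le_antisymm hle (h ▸ hw.1)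
      have h2 := Nat.eq_of_mul_eq_mul_right (hpos r) h1
      have hrp : r + 1 = p := by omega
      refine ⟨hrp, ?_⟩
      have h3 := hw.2 (h.trans h1.symm)
      ext n
      rw [Finset.mem_filter, mem_beadsOfLabels hp, List.length_singleton, Nat.div_lt_iff_lt_mul hp,
        one_mul, hrp]
      constructor
      · rintro ⟨hn, hlt⟩
        rw [Nat.div_eq_of_lt hlt, Nat.mod_eq_of_lt hlt]
        exact ⟨hlt, by simpa using (h3 n (by omega)).1 hn⟩
      · rintro ⟨hlt, hn⟩
        rw [Nat.div_eq_of_lt hlt, Nat.mod_eq_of_lt hlt] at hn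
        exact ⟨(h3 n (by omega)).2 (by simpa using hn), hlt⟩
  | succ j ih =>
    have hE : (j + 1) * p + r + 1 = (j * p + r + 1) + p := by ring
    have hE' : (j + 1) * p + r = (j * p + r) + p := by ring
    rw [hE'] at hj
    obtain ⟨g, hg, hlen, hsum, hlast, hle, heq⟩ := ih (hcl _ hj)
    rw [hE]
    set E := j * p + r + 1 with hEdef
    set l := windowGaps p B (E + p) with hl
    have hll : gapsBelow B (E + p) = gapsBelow B E + l := by
      have := gapsBelow_mono B (show E ≤ E + p by omega)
      rw [hl, windowGaps, Nat.add_sub_cancel]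
      omega
    have hend : gapsBelow B (E + p) = gapsBelow B (j * p + r + p) := by
      have : E + p = (j * p + r + p) + 1 := by omega
      rw [this, gapsBelow_succ, if_pos hj, add_zero]
    have hmono : ∀ a ∈ g, a ≤ l := fun a ha =>
      (hlast a ha).trans (windowGaps_le_windowGaps_add hcl E)
    have hl1 : 1 ≤ l := by
      have hne : g ≠ [] := fun h => by simp [h] at hlen
      obtain ⟨a, ha⟩ := List.exists_mem_of_ne_nil g hne
      exact (hg.one_le a ha).trans (hmono a ha)
    have hlp : l < p := by
      have := card_beads_add_gapsBelow B (show E ≤ j * p + r + p by omega)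
      omega
    have hw := sum_gapsBelow_window_le B (show E ≤ E + p by omega) hll
    rw [Nat.add_sub_cancel_left] at hw
    have hsplit := sum_filter_lt_eq_add B (show E ≤ E + p by omega) (gapsBelow B)
    have hsize := sizeOfLabels_append_singleton p g l
    rw [hsum, ← hll] at hsize
    refine ⟨g ++ [l], ?_, by simp [hlen], by simp [hsum, hll], ?_, by omega, ?_⟩
    · refine isLabelSequence_append_singleton.2 ⟨hg, hmono, hl1, hlp, ?_⟩
      rw [hsum, ← hll, hend]
      exact hpr _ hj
    · intro a ha
      rcases List.mem_append.1 ha with ha | ha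
      · exact hmono a ha
      · exact (List.mem_singleton.1 ha).le
    · intro h
      obtain ⟨hrp, hB⟩ := heq (by omega)
      have h3 := hw.2 (by omega)
      refine ⟨hrp, ?_⟩
      have hEp : E = g.length * p := by rw [hEdef, hlen, add_assoc, hrp]; ring
      ext n
      rw [mem_beadsOfLabels_append_singleton hp, ← hB, Finset.mem_filter, Finset.mem_filter]
      rcases Nat.lt_or_ge n E with hn | hn
      · have : n / p < g.length := (Nat.div_lt_iff_lt_mul hp).2 (by omega)
        have := this.ne
        simp only [this, hn, false_and, or_false, and_true, and_iff_left_iff_imp]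
        omega
      · have hx : ∃ x, n = E + x := Nat.exists_eq_add_of_le hn
        obtain ⟨x, rfl⟩ := hx
        have hnot : ¬ E + x < E := by omega
        simp only [hnot, and_false, false_or]
        rcases Nat.lt_or_ge x p with hxp | hxp
        · have hd : (E + x) / p = g.length := by
            rw [hEp, mul_comm, Nat.mul_add_div hp, Nat.div_eq_of_lt hxp, add_zero]
          have hm : (E + x) % p = x := by
            rw [hEp, mul_comm, Nat.mul_add_mod, Nat.mod_eq_of_lt hxp]
          have := h3 (E + x) hn (by omega)
          rw [hd, hm, this]
          omega
        · have : (E + x) / p ≠ g.length := by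
            have : g.length + 1 ≤ (E + x) / p := (Nat.le_div_iff_mul_le hp).2 (by rw [add_mul]; omega)
            omega
          simp only [this, false_and, iff_false, not_and]
          omega

theorem exists_labels_of_isCorePartition {p : ℕ} (hp : 0 < p) {ν : YoungDiagram}
    (hc : IsCorePartition p ν) (hpr : IsPrimePartition p ν) :
    ∃ g, IsLabelSequence p g ∧ ν.card ≤ sizeOfLabels p g ∧
      (ν.card = sizeOfLabels p g → beads ν = beadsOfLabels p g) := by
  rw [card_eq_sum_gapsBelow]
  rcases (beads ν).eq_empty_or_nonempty with hB | hB
  · refine ⟨[], IsLabelSequence.nil p, by simp [hB], fun _ => ?_⟩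
    simp [hB, beadsOfLabels]
  · set M := (beads ν).max' hB with hM
    have hMB : M ∈ beads ν := Finset.max'_mem _ hB
    have hcl : ∀ n, n + p ∈ beads ν → n ∈ beads ν := fun n hn => by
      by_contra h
      exact isCorePartition_iff.1 hc _ hn n (by omega) h (by simp)
    obtain ⟨g, hg, -, -, -, h1, h2⟩ := exists_labels_of_core (zero_notMem_beads ν) hcl
      (isPrimePartition_iff.1 hpr) (Nat.mod_lt M hp) (M / p) (by rwa [Nat.div_add_mod'])
    have e : (beads ν).filter (· < M / p * p + M % p + 1) = beads ν := by
      rw [Nat.div_add_mod', Finset.filter_eq_self]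
      exact fun n hn => Nat.lt_succ_of_le (Finset.le_max' _ n hn)
    rw [e] at h1 h2
    exact ⟨g, hg, h1, fun h => (h2 h).2⟩

theorem mainTheorem1 (p : ℕ) (hp : p.Prime) (hodd : Odd p) :
    ∃ (μ : YoungDiagram) (w : ResidueWalk p),
      (∀ ν : YoungDiagram, IsLargestCorePrimePartition p ν ↔ ν = μ) ∧
      (∀ v : ResidueWalk p, IsLongestWalk v ↔ v = w) ∧
      CorrespondsToWalk p μ w := by
  have : Fact p.Prime := ⟨hp⟩
  have hp0 := hp.pos
  obtain ⟨g, hg, ho⟩ := exists_isOptimalLabels hodd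
  obtain ⟨w, rfl⟩ := hg.exists_walk
  obtain ⟨μ, hμ⟩ := exists_beads_eq (hg.zero_notMem hp0)
  have hsize : μ.card = sizeOfLabels p w.labels := by
    rw [card_eq_sum_gapsBelow, hμ, hg.sum_gapsBelow hp0]
  have hcore := hg.isCorePartition hp0 hμ
  have hprime := hg.isPrimePartition hp0 hμ
  have hmax : ∀ ν : YoungDiagram, IsCorePartition p ν → IsPrimePartition p ν →
      ν.card ≤ μ.card ∧ (ν.card = μ.card → ν = μ) := by
    intro ν h1 h2
    obtain ⟨v, hv, hle, heq⟩ := exists_labels_of_isCorePartition hp0 h1 h2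
    obtain ⟨hle', heq'⟩ := ho.sizeOfLabels_le hg hv
    rw [hsize]
    refine ⟨hle.trans hle', fun h => beads_injective ?_⟩
    have hvw := heq' (le_antisymm hle' (h ▸ hle))
    rw [hμ, heq (by rw [h, hvw]), hvw]
  have hlong : ∀ v : ResidueWalk p, v.length ≤ w.length ∧ (v.length = w.length → v = w) := by
    intro v
    obtain ⟨h1, h2⟩ := ho.length_le hg (v.isLabelSequence_labels hp0)
    rw [v.length_labels, w.length_labels] at h1 h2
    exact ⟨h1, fun h => ResidueWalk.labels_injective (h2 h)⟩
  refine ⟨μ, w, fun ν => ⟨fun h => ?_, ?_⟩, fun v => ⟨fun h => ?_, ?_⟩, ?_, ?_⟩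
  · exact (hmax ν h.1 h.2.1).2 (le_antisymm (hmax ν h.1 h.2.1).1 (h.2.2 μ hcore hprime))
  · rintro rfl
    exact ⟨hcore, hprime, fun ν h1 h2 => (hmax ν h1 h2).1⟩
  · exact (hlong v).2 (le_antisymm (hlong v).1 (h w))
  · rintro rfl
    exact fun v => (hlong v).1
  · exact beadsRightmost_of_beads_eq hp0 hμ
  · rw [hg.abacusResidueSequence_eq hp0 hμ, w.visited_eq]
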